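/- Let $m,d\ge 1$, let $(X_k,Y_k)_{k\ge 0}$ be independent and identically distributed random pairs with values in $\mathbb R^m\times\mathbb R^d$, such that $\mathbb E\|X_0\|_2^{4+\Delta}<\infty$ and $\mathbb E\|Y_0\|_2^{4+\Delta}<\infty$ for some $\Delta>0$, and let $\Sigma=\mathbb E[X_0Y_0^\top]$. Fix $u_0\in\mathbb R^m$ and $v_0\in\mathbb R^d$ with $\|u_0\|_2=\|v_0\|_2=1$. For a step size $\eta>0$ let $(u_{\eta,k},v_{\eta,k})_{k\ge0}$ be the iterates of the stochastic generalized Hebbian algorithm (GHA), that is, $(u_{\eta,0},v_{\eta,0})=(u_0,v_0)$ and $$u_{\eta,k+1}=u_{\eta,k}+\eta\bigl(X_kY_k^\top v_{\eta,k}-(u_{\eta,k}^\top X_kY_k^\top v_{\eta,k})\,u_{\eta,k}\bigr),\qquad v_{\eta,k+1}=v_{\eta,k}+\eta\bigl(Y_kX_k^\top u_{\eta,k}-(u_{\eta,k}^\top X_kY_k^\top v_{\eta,k})\,v_{\eta,k}\bigr).$$ Let $U_\eta(t)=u_{\eta,\lfloor t/\eta\rfloor}$ and $V_\eta(t)=v_{\eta,\lfloor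 t/\eta\rfloor}$ for $t\ge 0$. Then the system $$\frac{dU}{dt}=\Sigma V-(U^\top\Sigma V)\,U,\qquad \frac{dV}{dt}=\Sigma^\top U-(U^\top\Sigma V)\,V,\qquad U(0)=u_0,\quad V(0)=v_0,$$ has a unique solution $(U,V)$ on $[0,\infty)$, and, as $\eta\to0^+$, the processes $(U_\eta,V_\eta)$ converge weakly to $(U,V)$, that is, in distribution in the space $D([0,\infty),\mathbb R^m\times\mathbb R^d)$ of càdlàg paths with the Skorokhod ($J_1$) topology. -/

import Mathlib

open MeasureTheory ProbabilityTheory Filter Topology Set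
open scoped NNReal ENNReal Matrix

noncomputable section

/-! ## The Skorokhod space `D([0,∞), E)` -/

/-- Càdlàg paths `[0,∞) → E`: right-continuous with left limits. At `t = 0` the filter `𝓝[<] t`
is trivial, so there the left-limit condition is empty. -/
structure CadlagPath (E : Type*) [TopologicalSpace E] where
  toFun : ℝ≥0 → E
  right_cont' : ∀ t, ContinuousWithinAt toFun (Ici t) t
  left_lim' : ∀ t, ∃ l, Tendsto toFun (𝓝[<] t) (𝓝 l)

namespace CadlagPath

instance {E : Type*} [TopologicalSpace E] : FunLike (CadlagPath E) ℝ≥0 E where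
  coe := toFun
  coe_injective x y h := by cases x; cases y; congr

variable {E : Type*} [PseudoMetricSpace E]

/-- The basic Skorokhod neighbourhood of `x`: the paths `y` that are `ε`-close to `x` on `[0,T]`
after a change of time `τ`, an increasing bijection of `[0,∞)`, that is `ε`-close to the identity
on `[0,T]`. -/
def skorokhodNhd (x : CadlagPath E) (T : ℝ≥0) (ε : ℝ) : Set (CadlagPath E) :=
  {y | ∃ τ : ℝ≥0 ≃o ℝ≥0, ∀ t ≤ T, dist (τ t) t < ε ∧ dist (y t) (x (τ t)) < ε}

theorem skorokhodNhd_mono (x : CadlagPath E) {S T : ℝ≥0} {ε δ : ℝ} (hT : S ≤ T) (hε : δ ≤ ε) :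
    skorokhodNhd x T δ ⊆ skorokhodNhd x S ε := by
  rintro y ⟨τ, h⟩
  exact ⟨τ, fun t ht => ⟨(h t (ht.trans hT)).1.trans_le hε, (h t (ht.trans hT)).2.trans_le hε⟩⟩

/-- The Skorokhod (J1) topology on `D([0,∞), E)`. In it `xₙ → x` if and only if for every `T`
there are increasing bijections `τₙ` of `[0,∞)` with `sup_{t ≤ T} |τₙ t - t| → 0` and
`sup_{t ≤ T} dist (xₙ t) (x (τₙ t)) → 0`. -/
instance : TopologicalSpace (CadlagPath E) where
  IsOpen O := ∀ x ∈ O, ∃ T : ℝ≥0, ∃ ε : ℝ, 0 < ε ∧ skorokhodNhd x T ε ⊆ O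
  isOpen_univ := fun _ _ => ⟨0, 1, one_pos, subset_univ _⟩
  isOpen_inter := by
    rintro O O' h h' x ⟨hx, hx'⟩
    obtain ⟨T, ε, hε, hO⟩ := h x hx
    obtain ⟨T', ε', hε', hO'⟩ := h' x hx'
    exact ⟨max T T', min ε ε', lt_min hε hε', subset_inter
      ((skorokhodNhd_mono x (le_max_left _ _) (min_le_left _ _)).trans hO)
      ((skorokhodNhd_mono x (le_max_right _ _) (min_le_right _ _)).trans hO')⟩
  isOpen_sUnion := by
    rintro C h x ⟨O, hO, hx⟩
    obtain ⟨T, ε, hε, hN⟩ := h O hO x hx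
    exact ⟨T, ε, hε, hN.trans (subset_sUnion_of_mem hO)⟩

/-- The Borel σ-algebra of the Skorokhod topology. -/
instance : MeasurableSpace (CadlagPath E) := borel _

instance : BorelSpace (CadlagPath E) := ⟨rfl⟩

end CadlagPath

/-- The piecewise-constant interpolation `t ↦ z_⌊t/η⌋` of a sequence, as a càdlàg path.
Only `η > 0` matters; for `η ≤ 0` it is the constant path `z 0`. -/
def stepPath {E : Type*} [TopologicalSpace E] (η : ℝ) (z : ℕ → E) : CadlagPath E where
  toFun t := z ⌊(t : ℝ) / η⌋₊
  right_cont' := by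
    intro t
    refine (tendsto_const_nhds (x := z ⌊(t : ℝ) / η⌋₊)).congr' ?_
    rcases le_or_gt η 0 with hη | hη
    · refine Eventually.of_forall fun s => ?_
      simp only
      rw [Nat.floor_of_nonpos (div_nonpos_of_nonneg_of_nonpos t.coe_nonneg hη),
        Nat.floor_of_nonpos (div_nonpos_of_nonneg_of_nonpos s.coe_nonneg hη)]
    · have hlt : (t : ℝ) < (⌊(t : ℝ) / η⌋₊ + 1) * η :=
        (div_lt_iff₀ hη).1 (Nat.lt_floor_add_one _)
      have hev : ∀ᶠ s : ℝ≥0 in 𝓝[≥] t, (s : ℝ) < (⌊(t : ℝ) / η⌋₊ + 1) * η :=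
        nhdsWithin_le_nhds
          ((NNReal.continuous_coe.tendsto t).eventually (eventually_lt_nhds hlt))
      filter_upwards [hev, self_mem_nhdsWithin] with s hs hts
      have hts' : (t : ℝ) ≤ s := hts
      have h1 : ⌊(t : ℝ) / η⌋₊ ≤ ⌊(s : ℝ) / η⌋₊ := Nat.floor_mono (by gcongr)
      have h2 : ⌊(s : ℝ) / η⌋₊ < ⌊(t : ℝ) / η⌋₊ + 1 := by
        rw [Nat.floor_lt (div_nonneg s.coe_nonneg hη.le), div_lt_iff₀ hη]
        exact_mod_cast hs
      congr 1
      omega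
  left_lim' := by
    intro t
    refine ⟨z (⌈(t : ℝ) / η⌉₊ - 1), (tendsto_const_nhds).congr' ?_⟩
    rcases le_or_gt η 0 with hη | hη
    · refine Eventually.of_forall fun s => ?_
      beta_reduce
      rw [Nat.ceil_eq_zero.2 (div_nonpos_of_nonneg_of_nonpos t.coe_nonneg hη),
        Nat.floor_of_nonpos (div_nonpos_of_nonneg_of_nonpos s.coe_nonneg hη)]
    · have hev : ∀ᶠ s : ℝ≥0 in 𝓝[<] t, ((⌈(t : ℝ) / η⌉₊ - 1 : ℕ) : ℝ) * η ≤ s := by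
        rcases Nat.eq_zero_or_pos (⌈(t : ℝ) / η⌉₊ - 1) with h0 | h0
        · refine Eventually.of_forall fun s => ?_
          rw [h0]
          simp
        · have hlt : ((⌈(t : ℝ) / η⌉₊ - 1 : ℕ) : ℝ) * η < t :=
            (lt_div_iff₀ hη).1 (Nat.lt_ceil.1 (by omega))
          exact nhdsWithin_le_nhds
            (((NNReal.continuous_coe.tendsto t).eventually (eventually_gt_nhds hlt)).mono
              fun _ h => le_of_lt h)
      filter_upwards [hev, self_mem_nhdsWithin] with s hs hst
      have hst' : (s : ℝ) < t := hst
      have h1 : ⌈(t : ℝ) / η⌉₊ - 1 ≤ ⌊(s : ℝ) / η⌋₊ := Nat.le_floor ((le_div_iff₀ hη).2 hs)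
      have h2 : ⌊(s : ℝ) / η⌋₊ < ⌈(t : ℝ) / η⌉₊ := by
        rw [Nat.floor_lt (div_nonneg s.coe_nonneg hη.le)]
        exact (div_lt_div_of_pos_right hst' hη).trans_le (Nat.le_ceil _)
      congr 1
      omega

/-! ## The generalized Hebbian algorithm -/

/-- The pairs `(u, v)` with `u ∈ ℝᵐ`, `v ∈ ℝᵈ`; each factor carries its Euclidean norm. -/
abbrev VecPair (m d : ℕ) : Type := EuclideanSpace ℝ (Fin m) × EuclideanSpace ℝ (Fin d)

/-- The vector field `(u, v) ↦ (M v - (uᵀ M v) u, Mᵀ u - (uᵀ M v) v)` of an `m × d` matrix `M`. -/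
def ghaField {m d : ℕ} (M : Matrix (Fin m) (Fin d) ℝ) (w : VecPair m d) : VecPair m d :=
  (M.toEuclideanLin w.2 - (inner ℝ w.1 (M.toEuclideanLin w.2)) • w.1,
    Mᵀ.toEuclideanLin w.1 - (inner ℝ w.1 (M.toEuclideanLin w.2)) • w.2)

/-- The iterates `(u_k, v_k)` of the stochastic generalized Hebbian algorithm with step size `η`,
initial point `w₀ = (u₀, v₀)` and samples `(x_k, y_k)`:
`u_{k+1} = u_k + η (x_k y_kᵀ v_k - (u_kᵀ x_k y_kᵀ v_k) u_k)`,
`v_{k+1} = v_k + η (y_k x_kᵀ u_k - (u_kᵀ x_k y_kᵀ v_k) v_k)`. -/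
def ghaIter {m d : ℕ} (η : ℝ) (w₀ : VecPair m d) (x : ℕ → EuclideanSpace ℝ (Fin m))
    (y : ℕ → EuclideanSpace ℝ (Fin d)) : ℕ → VecPair m d
  | 0 => w₀
  | k + 1 => ghaIter η w₀ x y k +
      η • ghaField (Matrix.vecMulVec (x k) (y k)) (ghaIter η w₀ x y k)

/-- The matrix `Σ_XY = E[X Yᵀ]` when `(X, Y)` has law `𝓓`. -/
def crossMoment {m d : ℕ} (𝓓 : Measure (VecPair m d)) : Matrix (Fin m) (Fin d) ℝ :=
  Matrix.of fun i j => ∫ p, p.1 i * p.2 j ∂𝓓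

/-- `W = (U, V) : [0,∞) → ℝᵐ × ℝᵈ` solves `U' = M V - (Uᵀ M V) U`, `V' = Mᵀ U - (Uᵀ M V) V`
with `W 0 = w₀` (the derivative at `0` is one-sided). -/
def IsGhaSolution {m d : ℕ} (M : Matrix (Fin m) (Fin d) ℝ) (w₀ : VecPair m d)
    (W : ℝ≥0 → VecPair m d) : Prop :=
  W 0 = w₀ ∧ ∀ t : ℝ≥0,
    HasDerivWithinAt (fun s : ℝ => W s.toNNReal) (ghaField M (W t)) (Ici 0) (t : ℝ)

end

/-! The convergence is pathwise. With `A k = X k (Y k)ᵀ` the algorithm reads `w (k+1) = w k + η F (A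
k) (w k)`, where the field `F` is linear in the matrix, so replacing `A k` by its mean `Σ` gives an
Euler scheme for the limiting equation. By the strong law, almost surely the averages of `A k` tend
to `Σ` and those of `‖A k‖` converge. The rest is deterministic on this event, which does not depend
on `η`.

The error committed by replacing `A k` by `Σ` is `η ∑ F (A j - Σ) (w j)`. Summation by parts bounds
it by `η` times the largest centred partial sum times one plus the variation of `w`. The centred
sums are `o(n)` and `n ≤ T/η`, so the first product tends to `0`; the averages of `‖A k‖` keep the
variation bounded. Grönwall's inequality then gives uniform convergence on `[0,T]`
(`IsAdditiveField.eventually_dist_iter_lt`).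

The field is cubic, so its Lipschitz bound is only local. The limit stays in the unit ball, and as
long as the error is at most `1` the iterates stay in the ball of radius `2`; the Grönwall argument
sustains this condition by itself. The limit exists globally because it is a normalized linear flow
(`exists_hebbian_flow`). Since it is deterministic and continuous, almost sure locally uniform
convergence implies weak convergence in the Skorokhod space. -/

/-! ## Deterministic averaging -/

/-- A discrete Grönwall inequality in which the recursive bound is only known as long as the
sequence stays below `1`. -/
theorem discrete_gronwall_of_le_one {e : ℕ → ℝ} {ε h : ℝ} {N : ℕ} (hε : 0 ≤ ε) (hh : 0 ≤ h)
    (hsmall : ε * (1 + h) ^ N ≤ 1)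
    (hrec : ∀ n ≤ N, (∀ j < n, e j ≤ 1) → e n ≤ ε + h * ∑ j ∈ Finset.range n, e j) :
    ∀ n ≤ N, e n ≤ ε * (1 + h) ^ n := by
  intro n
  induction n using Nat.strong_induction_on with
  | _ n ih =>
    intro hn
    have hlt : ∀ j < n, e j ≤ ε * (1 + h) ^ j := fun j hj => ih j hj (hj.le.trans hn)
    -- The inductive bound together with `hsmall` gives the condition under which `hrec` may be used
    -- at `n`.
    have hone : ∀ j < n, e j ≤ 1 := fun j hj =>
      (hlt j hj).trans (le_trans (mul_le_mul_of_nonneg_left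
        (pow_le_pow_right₀ (by linarith) (hj.le.trans hn)) hε) hsmall)
    refine (hrec n hn hone).trans ?_
    have hsum : ∑ j ∈ Finset.range n, e j ≤ ∑ j ∈ Finset.range n, ε * (1 + h) ^ j :=
      Finset.sum_le_sum fun j hj => hlt j (Finset.mem_range.1 hj)
    have hgeom : h * ∑ j ∈ Finset.range n, (1 + h) ^ j = (1 + h) ^ n - 1 := by
      have := mul_geom_sum (1 + h) n
      simpa using this
    calc ε + h * ∑ j ∈ Finset.range n, e j
        ≤ ε + h * ∑ j ∈ Finset.range n, ε * (1 + h) ^ j := by gcongr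
      _ = ε + ε * (h * ∑ j ∈ Finset.range n, (1 + h) ^ j) := by
          rw [← Finset.mul_sum]; ring
      _ = ε * (1 + h) ^ n := by rw [hgeom]; ring

section Averaging

variable {𝓐 E : Type*} [NormedAddCommGroup 𝓐] [NormedAddCommGroup E]

/-- A vector field `F a` that depends additively on a parameter `a`, with norm and Lipschitz
constant on the ball of radius `2` bounded by `C ‖a‖`. -/
structure IsAdditiveField (F : 𝓐 → E → E) (C : ℝ) : Prop where
  map_sub : ∀ a b w, F (a - b) w = F a w - F b w
  norm_le : ∀ a w, ‖w‖ ≤ 2 → ‖F a w‖ ≤ C * ‖a‖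
  norm_sub_le : ∀ a w w', ‖w‖ ≤ 2 → ‖w'‖ ≤ 2 → ‖F a w - F a w'‖ ≤ C * ‖a‖ * ‖w - w'‖

variable {F : 𝓐 → E → E} {C : ℝ}

/-- Summation by parts for `∑ F (S (j+1) - S j) (w j)`. -/
theorem IsAdditiveField.sum_by_parts (hF : IsAdditiveField F C) (S : ℕ → 𝓐) (h0 : S 0 = 0)
    (w : ℕ → E) (n : ℕ) :
    ∑ j ∈ Finset.range (n + 1), F (S (j + 1) - S j) (w j) =
      F (S (n + 1)) (w n) -
        ∑ j ∈ Finset.range n, (F (S (j + 1)) (w (j + 1)) - F (S (j + 1)) (w j)) := by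
  induction n with
  | zero => simp [h0]
  | succ n ih =>
    rw [Finset.sum_range_succ, ih, Finset.sum_range_succ, hF.map_sub]
    abel

/-- After summation by parts the increments of `S` no longer occur: cancellation in `S` is kept, at
the price of the variation of `w`. Only `w 0, …, w (n-1)` enter, hence the range `n - 1`. -/
theorem IsAdditiveField.norm_sum_le (hF : IsAdditiveField F C) (hC : 0 ≤ C) {S : ℕ → 𝓐}
    (h0 : S 0 = 0) {w : ℕ → E} {n : ℕ} {M V : ℝ} (hM : 0 ≤ M) (hV : 0 ≤ V)
    (hS : ∀ j ≤ n, ‖S j‖ ≤ M) (hw : ∀ j < n, ‖w j‖ ≤ 2)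
    (hvar : ∑ j ∈ Finset.range (n - 1), ‖w (j + 1) - w j‖ ≤ V) :
    ‖∑ j ∈ Finset.range n, F (S (j + 1) - S j) (w j)‖ ≤ C * M * (1 + V) := by
  rcases n with _ | n
  · simp only [Finset.range_zero, Finset.sum_empty, norm_zero]; positivity
  rw [hF.sum_by_parts S h0]
  have h1 : ‖F (S (n + 1)) (w n)‖ ≤ C * M :=
    (hF.norm_le _ _ (hw n (by omega))).trans (mul_le_mul_of_nonneg_left (hS _ le_rfl) hC)
  have h2 : ‖∑ j ∈ Finset.range n, (F (S (j + 1)) (w (j + 1)) - F (S (j + 1)) (w j))‖ ≤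
      C * M * V := by
    refine (_root_.norm_sum_le _ _).trans ?_
    calc ∑ j ∈ Finset.range n, ‖F (S (j + 1)) (w (j + 1)) - F (S (j + 1)) (w j)‖
        ≤ ∑ j ∈ Finset.range n, C * M * ‖w (j + 1) - w j‖ := by
          refine Finset.sum_le_sum fun j hj => ?_
          have hj' := Finset.mem_range.1 hj
          refine (hF.norm_sub_le _ _ _ (hw _ (by omega)) (hw _ (by omega))).trans ?_
          have := hS (j + 1) (by omega)
          gcongr
      _ = C * M * ∑ j ∈ Finset.range n, ‖w (j + 1) - w j‖ := by rw [Finset.mul_sum]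
      _ ≤ C * M * V := by
          have : ∑ j ∈ Finset.range n, ‖w (j + 1) - w j‖ ≤ V := by simpa using hvar
          gcongr
  calc _ ≤ _ := _root_.norm_sub_le _ _
    _ ≤ C * M * (1 + V) := by linarith

variable [NormedSpace ℝ E]

/-- A solution with values in the unit ball of `W' = F s W` has Lipschitz constant `C ‖s‖`. -/
theorem IsAdditiveField.norm_solution_sub_le (hF : IsAdditiveField F C) {s : 𝓐} {W : ℝ → E}
    (hW : ∀ t, 0 ≤ t → HasDerivWithinAt W (F s (W t)) (Ici 0) t) (hb : ∀ t, 0 ≤ t → ‖W t‖ ≤ 1)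
    {t t' : ℝ} (ht : 0 ≤ t) (ht' : 0 ≤ t') : ‖W t' - W t‖ ≤ C * ‖s‖ * |t' - t| := by
  simpa [Real.norm_eq_abs] using (convex_Ici (0 : ℝ)).norm_image_sub_le_of_norm_hasDerivWithin_le
    (fun x hx => hW x hx) (fun x hx => hF.norm_le s _ ((hb x hx).trans one_le_two)) ht ht'

/-- Mean value inequality for `r ↦ W r - r • F s (W t)`: its derivative is at most the Lipschitz
constant `C ‖s‖` times the displacement `C ‖s‖ η`, and the interval has length `η`. -/
theorem IsAdditiveField.norm_euler_error_le (hF : IsAdditiveField F C) (hC : 0 ≤ C) {s : 𝓐}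
    {W : ℝ → E}
    (hW : ∀ t, 0 ≤ t → HasDerivWithinAt W (F s (W t)) (Ici 0) t) (hb : ∀ t, 0 ≤ t → ‖W t‖ ≤ 1)
    {t η : ℝ} (ht : 0 ≤ t) (hη : 0 ≤ η) :
    ‖W (t + η) - W t - η • F s (W t)‖ ≤ (C * ‖s‖ * η) ^ 2 := by
  have hsub : Icc t (t + η) ⊆ Ici 0 := fun x hx => ht.trans hx.1
  have key := (convex_Icc t (t + η)).norm_image_sub_le_of_norm_hasDerivWithin_le
    (f := fun r => W r - r • F s (W t)) (f' := fun r => F s (W r) - F s (W t))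
    (C := C * ‖s‖ * (C * ‖s‖ * η))
    (fun x hx => by
      have h2 := ((hasDerivAt_id x).smul_const (F s (W t))).hasDerivWithinAt (s := Icc t (t + η))
      exact (((hW x (hsub hx)).mono hsub).sub h2).congr_deriv (by simp))
    (fun x hx => by
      refine (hF.norm_sub_le s _ _ ((hb x (hsub hx)).trans one_le_two)
        ((hb t ht).trans one_le_two)).trans ?_
      have h3 := hF.norm_solution_sub_le hW hb ht (hsub hx)
      have h4 : |x - t| ≤ η := by rw [abs_of_nonneg (by linarith [hx.1])]; linarith [hx.2]
      have : ‖W x - W t‖ ≤ C * ‖s‖ * η := h3.trans (by gcongr)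
      gcongr)
    (left_mem_Icc.2 (by linarith)) (right_mem_Icc.2 (by linarith))
  have e1 : W (t + η) - W t - η • F s (W t) =
      (W (t + η) - (t + η) • F s (W t)) - (W t - t • F s (W t)) := by
    rw [add_smul]; abel
  rw [e1]
  refine key.trans (le_of_eq ?_)
  rw [add_sub_cancel_left, Real.norm_of_nonneg hη]; ring

/-- Quantitative averaging: the recursion `w (k+1) = w k + η F (A k) (w k)` follows the solution
of `W' = F s W` as long as the centred partial sums of `A` stay below `M`. -/
theorem IsAdditiveField.norm_iter_sub_solution_le (hF : IsAdditiveField F C) (hC : 0 ≤ C)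
    {s : 𝓐} {W : ℝ → E}
    (hW : ∀ t, 0 ≤ t → HasDerivWithinAt W (F s (W t)) (Ici 0) t) (hb : ∀ t, 0 ≤ t → ‖W t‖ ≤ 1)
    {A : ℕ → 𝓐} {w : ℕ → E} {η T M B : ℝ} {N : ℕ} (hη : 0 ≤ η) (hM : 0 ≤ M) (hB : 0 ≤ B)
    (hT : 0 ≤ T) (hN : N * η ≤ T) (hw0 : w 0 = W 0)
    (hw : ∀ k, w (k + 1) = w k + η • F (A k) (w k))
    (hS : ∀ n ≤ N, ‖∑ j ∈ Finset.range n, (A j - s)‖ ≤ M)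
    (hA : η * ∑ j ∈ Finset.range N, ‖A j‖ ≤ B)
    (hsmall : (η * (C * M * (1 + C * B)) + T * (C * ‖s‖) ^ 2 * η) *
      Real.exp (C * ‖s‖ * T) ≤ 1) :
    ∀ n ≤ N, ‖w n - W (n * η)‖ ≤ (η * (C * M * (1 + C * B)) + T * (C * ‖s‖) ^ 2 * η) *
      Real.exp (C * ‖s‖ * T) := by
  -- `ε` collects the noise bound and the accumulated Euler error; `h` is the Lipschitz growth per
  -- step.
  set ε := η * (C * M * (1 + C * B)) + T * (C * ‖s‖) ^ 2 * η with hεdef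
  set h := η * (C * ‖s‖) with hhdef
  have hε : 0 ≤ ε := by positivity
  have hh : 0 ≤ h := by positivity
  have hpow : ∀ n ≤ N, (1 + h) ^ n ≤ Real.exp (C * ‖s‖ * T) := by
    intro n hn
    calc (1 + h) ^ n ≤ Real.exp h ^ n :=
          pow_le_pow_left₀ (by linarith) (by linarith [Real.add_one_le_exp h]) n
      _ = Real.exp (n * h) := by rw [← Real.exp_nat_mul]
      _ ≤ _ := by
          refine Real.exp_le_exp.2 ?_
          have h1 : (n : ℝ) * η ≤ T := le_trans (by gcongr) hN
          calc (n : ℝ) * h = C * ‖s‖ * (n * η) := by rw [hhdef]; ring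
            _ ≤ _ := by gcongr
  have main : ∀ n ≤ N, ‖w n - W (n * η)‖ ≤ ε * (1 + h) ^ n := by
    refine discrete_gronwall_of_le_one hε hh
      ((mul_le_mul_of_nonneg_left (hpow N le_rfl) hε).trans hsmall) ?_
    intro n hn hlt
    have hball : ∀ j < n, ‖w j‖ ≤ 2 := by
      intro j hj
      have h1 := hlt j hj
      have h2 := hb (j * η) (by positivity)
      calc ‖w j‖ = ‖(w j - W (j * η)) + W (j * η)‖ := by rw [sub_add_cancel]
        _ ≤ _ := norm_add_le _ _
        _ ≤ 2 := by linarith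
    have hWball : ∀ j : ℕ, ‖W (j * η)‖ ≤ 2 := fun j => (hb _ (by positivity)).trans one_le_two
    let S : ℕ → 𝓐 := fun n => ∑ j ∈ Finset.range n, (A j - s)
    have hSd : ∀ j, S (j + 1) - S j = A j - s := fun j => by
      simp only [S, Finset.sum_range_succ, add_sub_cancel_left]
    let R : ℕ → E := fun j => W (j * η + η) - W (j * η) - η • F s (W (j * η))
    -- The error splits into the difference of the mean fields, the centred noise and the Euler
    -- remainders, bounded by `b1`, `b2` and `b3` respectively.
    have htel : ∀ k, w k - W (k * η) =
        η • ∑ j ∈ Finset.range k, (F s (w j) - F s (W (j * η))) +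
          η • ∑ j ∈ Finset.range k, F (S (j + 1) - S j) (w j) - ∑ j ∈ Finset.range k, R j := by
      intro k
      induction k with
      | zero => simp [hw0]
      | succ k ih =>
        have e1 : ((k + 1 : ℕ) : ℝ) * η = k * η + η := by push_cast; ring
        have e2 : w k = (w k - W (k * η)) + W (k * η) := by abel
        simp only [Finset.sum_range_succ]
        rw [e1, hw, hSd, hF.map_sub]
        simp only [smul_add, smul_sub]
        simp only [hSd] at ih
        have e3 : R k = W (k * η + η) - W (k * η) - η • F s (W (k * η)) := rfl
        rw [e3]
        calc w k + η • F (A k) (w k) - W (k * η + η)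
            = (w k - W (k * η)) + (η • F (A k) (w k) - (W (k * η + η) - W (k * η))) := by abel
          _ = _ := by rw [ih]; simp only [hSd]; abel
    rw [htel n]
    have b1 : ‖∑ j ∈ Finset.range n, (F s (w j) - F s (W (j * η)))‖ ≤
        C * ‖s‖ * ∑ j ∈ Finset.range n, ‖w j - W (j * η)‖ := by
      rw [Finset.mul_sum]
      exact norm_sum_le_of_le _ fun j hj =>
        hF.norm_sub_le _ _ _ (hball j (Finset.mem_range.1 hj)) (hWball j)
    have b2 : ‖∑ j ∈ Finset.range n, F (S (j + 1) - S j) (w j)‖ ≤ C * M * (1 + C * B) := by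
      refine hF.norm_sum_le hC (by simp [S]) hM (by positivity) (fun j hj => hS j (hj.trans hn))
        hball ?_
      -- Each step of `w` has length at most `η C ‖A j‖`, so the variation is at most `C B`.
      calc ∑ j ∈ Finset.range (n - 1), ‖w (j + 1) - w j‖
          ≤ ∑ j ∈ Finset.range (n - 1), η * (C * ‖A j‖) := by
            refine Finset.sum_le_sum fun j hj => ?_
            have hj' := Finset.mem_range.1 hj
            rw [hw, add_sub_cancel_left, norm_smul, Real.norm_of_nonneg hη]
            exact mul_le_mul_of_nonneg_left (hF.norm_le _ _ (hball j (by omega))) hη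
        _ ≤ ∑ j ∈ Finset.range N, η * (C * ‖A j‖) :=
            Finset.sum_le_sum_of_subset_of_nonneg
              (Finset.range_subset_range.2 (by omega)) fun j _ _ => by positivity
        _ = C * (η * ∑ j ∈ Finset.range N, ‖A j‖) := by
            rw [Finset.mul_sum, Finset.mul_sum]
            exact Finset.sum_congr rfl fun j _ => by ring
        _ ≤ C * B := by gcongr
    have b3 : ‖∑ j ∈ Finset.range n, R j‖ ≤ T * (C * ‖s‖) ^ 2 * η := by
      calc ‖∑ j ∈ Finset.range n, R j‖ ≤ ∑ _j ∈ Finset.range n, (C * ‖s‖ * η) ^ 2 :=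
            norm_sum_le_of_le _ fun j _ => hF.norm_euler_error_le hC hW hb (by positivity) hη
        _ = (n * η) * ((C * ‖s‖) ^ 2 * η) := by
            rw [Finset.sum_const, Finset.card_range, nsmul_eq_mul]; ring
        _ ≤ T * ((C * ‖s‖) ^ 2 * η) := by
            have h1 : (n : ℝ) * η ≤ T := le_trans (by gcongr) hN
            gcongr
        _ = _ := by ring
    calc _ ≤ _ := _root_.norm_sub_le _ _
      _ ≤ ‖η • ∑ j ∈ Finset.range n, (F s (w j) - F s (W (j * η)))‖ +
          ‖η • ∑ j ∈ Finset.range n, F (S (j + 1) - S j) (w j)‖ +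
          ‖∑ j ∈ Finset.range n, R j‖ := by gcongr; exact norm_add_le _ _
      _ ≤ η * (C * ‖s‖ * ∑ j ∈ Finset.range n, ‖w j - W (j * η)‖) +
          η * (C * M * (1 + C * B)) + T * (C * ‖s‖) ^ 2 * η := by
          rw [norm_smul, norm_smul, Real.norm_of_nonneg hη]
          gcongr
      _ = _ := by rw [hεdef, hhdef]; ring
  exact fun n hn => (main n hn).trans (mul_le_mul_of_nonneg_left (hpow n hn) hε)

end Averaging

/-- If `n⁻¹ S n → 0` then `‖S n‖ ≤ K + ε n` for every `ε > 0`. -/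
theorem exists_norm_le_add_mul_of_tendsto_zero {E : Type*} [NormedAddCommGroup E]
    [NormedSpace ℝ E] {S : ℕ → E}
    (h : Tendsto (fun n : ℕ => (n : ℝ)⁻¹ • S n) atTop (𝓝 0)) {ε : ℝ} (hε : 0 < ε) :
    ∃ K, 0 ≤ K ∧ ∀ n, ‖S n‖ ≤ K + ε * n := by
  have h1 : ∀ᶠ n : ℕ in atTop, ‖S n‖ ≤ ε * n := by
    filter_upwards [(tendsto_zero_iff_norm_tendsto_zero.1 h).eventually_lt_const hε,
      eventually_gt_atTop 0] with n hn hpos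
    have hpos' : (0 : ℝ) < n := by exact_mod_cast hpos
    rw [norm_smul, norm_inv, Real.norm_of_nonneg hpos'.le, inv_mul_lt_iff₀ hpos'] at hn
    linarith [mul_comm ε (n : ℝ)]
  obtain ⟨n₀, hn₀⟩ := eventually_atTop.1 h1
  refine ⟨∑ j ∈ Finset.range n₀, ‖S j‖, by positivity, fun n => ?_⟩
  rcases lt_or_ge n n₀ with hn | hn
  · have := Finset.single_le_sum (f := fun j => ‖S j‖) (fun j _ => norm_nonneg _)
      (Finset.mem_range.2 hn)
    have h2 : 0 ≤ ε * n := by positivity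
    linarith
  · have : 0 ≤ ∑ j ∈ Finset.range n₀, ‖S j‖ := by positivity
    linarith [hn₀ n hn]

/-- Averaging: if `A` has Cesàro mean `s` and bounded absolute Cesàro means, then as `η → 0⁺` the
interpolated recursion `w (k+1) = w k + η F (A k) (w k)` converges to the solution of `W' = F s W`,
uniformly on compact intervals. -/
theorem IsAdditiveField.eventually_dist_iter_lt {𝓐 E : Type*} [NormedAddCommGroup 𝓐]
    [NormedSpace ℝ 𝓐] [NormedAddCommGroup E] [NormedSpace ℝ E] {F : 𝓐 → E → E} {C : ℝ}
    (hF : IsAdditiveField F C) (hC : 0 ≤ C) {s : 𝓐} {W : ℝ → E}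
    (hW : ∀ t, 0 ≤ t → HasDerivWithinAt W (F s (W t)) (Ici 0) t) (hb : ∀ t, 0 ≤ t → ‖W t‖ ≤ 1)
    {A : ℕ → 𝓐} {w : ℝ → ℕ → E} (hw0 : ∀ η, w η 0 = W 0)
    (hw : ∀ η k, w η (k + 1) = w η k + η • F (A k) (w η k))
    (hmean : Tendsto (fun n : ℕ => (n : ℝ)⁻¹ • ∑ j ∈ Finset.range n, A j) atTop (𝓝 s))
    {b : ℝ}
    (habs : Tendsto (fun n : ℕ => (n : ℝ)⁻¹ • ∑ j ∈ Finset.range n, ‖A j‖) atTop (𝓝 b))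
    {T ε : ℝ} (hT : 0 ≤ T) (hε : 0 < ε) :
    ∀ᶠ η in 𝓝[>] (0 : ℝ), ∀ t, 0 ≤ t → t ≤ T → dist (w η ⌊t / η⌋₊) (W t) < ε := by
  have hcent : Tendsto (fun n : ℕ => (n : ℝ)⁻¹ • ∑ j ∈ Finset.range n, (A j - s)) atTop (𝓝 0) := by
    rw [← sub_self s]
    refine (hmean.sub tendsto_const_nhds).congr' ?_
    filter_upwards [eventually_gt_atTop 0] with n hn
    rw [Finset.sum_sub_distrib, Finset.sum_const, Finset.card_range, smul_sub,
      ← Nat.cast_smul_eq_nsmul ℝ, inv_smul_smul₀ (by positivity)]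
  obtain ⟨K, hK⟩ := habs.norm.bddAbove_range
  have hK' : ∀ n : ℕ, ∑ j ∈ Finset.range n, ‖A j‖ ≤ |K| * n := by
    intro n
    rcases Nat.eq_zero_or_pos n with rfl | hn
    · simp
    have hn' : (0 : ℝ) < n := by exact_mod_cast hn
    have h1 := (le_abs_self _).trans (hK (mem_range_self n))
    rw [smul_eq_mul, inv_mul_le_iff₀ hn'] at h1
    nlinarith [le_abs_self K]
  set B := |K| * T
  have hB : 0 ≤ B := by positivity
  set L := Real.exp (C * ‖s‖ * T)
  set D := C * (1 + C * B) with hDdef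
  have hD : 0 ≤ D := by positivity
  have hL : 0 < L := Real.exp_pos _
  -- `κ` is chosen so that the contribution of the centred sums is at most `min ε 1 / 4`.
  set κ := min ε 1 / (4 * (T + 1) * (D + 1) * L) with hκdef
  have hm : 0 < min ε 1 := lt_min hε one_pos
  have hκ : 0 < κ := by positivity
  obtain ⟨K₁, hK₁, hS⟩ := exists_norm_le_add_mul_of_tendsto_zero hcent hκ
  -- This is the part of the error that vanishes with `η`. The last summand is the motion of `W`
  -- between the grid point `⌊t/η⌋ η` and `t`.
  have hlim : Tendsto (fun η : ℝ => (η * (D * K₁) + T * (C * ‖s‖) ^ 2 * η) * L + C * ‖s‖ * η)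
      (𝓝[>] 0) (𝓝 0) := by
    have : Continuous fun η : ℝ =>
      (η * (D * K₁) + T * (C * ‖s‖) ^ 2 * η) * L + C * ‖s‖ * η := by fun_prop
    have h0 := this.tendsto 0
    simp only [zero_mul, mul_zero, add_zero] at h0
    exact h0.mono_left nhdsWithin_le_nhds
  filter_upwards [hlim.eventually_lt_const (show (0 : ℝ) < min ε 1 / 2 by positivity),
    self_mem_nhdsWithin] with η hηs hη t ht htT
  have hη' : 0 < η := hη
  set N := ⌊T / η⌋₊
  have hN : N * η ≤ T := (le_div_iff₀ hη').1 (Nat.floor_le (by positivity))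
  set M := K₁ + κ * N
  have hκT : κ * T * D * L ≤ min ε 1 / 4 := by
    rw [hκdef]
    have h1 : T * D * L ≤ (T + 1) * (D + 1) * L := by gcongr <;> linarith
    calc min ε 1 / (4 * (T + 1) * (D + 1) * L) * T * D * L
        = min ε 1 / (4 * (T + 1) * (D + 1) * L) * (T * D * L) := by ring
      _ ≤ min ε 1 / (4 * (T + 1) * (D + 1) * L) * ((T + 1) * (D + 1) * L) := by gcongr
      _ = min ε 1 / 4 := by field_simp
  -- Being below `1` supplies the smallness condition of the quantitative estimate; being below `ε`
  -- is the conclusion.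
  have hbound : (η * (C * M * (1 + C * B)) + T * (C * ‖s‖) ^ 2 * η) * L + C * ‖s‖ * η
      < min ε 1 := by
    have h1 : η * (C * M * (1 + C * B)) ≤ η * (D * K₁) + κ * T * D := by
      calc η * (C * M * (1 + C * B)) = η * (D * K₁) + κ * (N * η) * D := by
            simp only [M, hDdef]; ring
        _ ≤ _ := by gcongr
    calc (η * (C * M * (1 + C * B)) + T * (C * ‖s‖) ^ 2 * η) * L + C * ‖s‖ * η
        ≤ (η * (D * K₁) + κ * T * D + T * (C * ‖s‖) ^ 2 * η) * L + C * ‖s‖ * η := by gcongr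
      _ = ((η * (D * K₁) + T * (C * ‖s‖) ^ 2 * η) * L + C * ‖s‖ * η) + κ * T * D * L := by ring
      _ < min ε 1 := by linarith
  have hstep : 0 ≤ C * ‖s‖ * η := by positivity
  have key := hF.norm_iter_sub_solution_le hC hW hb (A := A) (w := w η) (η := η) (T := T) (M := M)
    (B := B) (N := N) hη'.le (by positivity) hB hT hN (hw0 η) (hw η)
    (fun n hn => (hS n).trans (by simp only [M]; gcongr))
    (by
      calc η * ∑ j ∈ Finset.range N, ‖A j‖ ≤ η * (|K| * N) := by gcongr; exact hK' N
        _ = |K| * (N * η) := by ring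
        _ ≤ B := by simp only [B]; gcongr)
    (by linarith [min_le_right ε 1])
    ⌊t / η⌋₊ (Nat.floor_mono (by gcongr))
  have hle : (⌊t / η⌋₊ : ℝ) * η ≤ t := (le_div_iff₀ hη').1 (Nat.floor_le (by positivity))
  have hlt : t < (⌊t / η⌋₊ + 1) * η := (div_lt_iff₀ hη').1 (Nat.lt_floor_add_one _)
  have hlip := hF.norm_solution_sub_le hW hb ht (t' := ⌊t / η⌋₊ * η) (by positivity)
  have habs' : |(⌊t / η⌋₊ : ℝ) * η - t| ≤ η := by
    rw [abs_le]; constructor <;> linarith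
  rw [dist_eq_norm]
  calc ‖w η ⌊t / η⌋₊ - W t‖
      = ‖(w η ⌊t / η⌋₊ - W (⌊t / η⌋₊ * η)) + (W (⌊t / η⌋₊ * η) - W t)‖ := by
        congr 1; abel
    _ ≤ _ := norm_add_le _ _
    _ ≤ (η * (C * M * (1 + C * B)) + T * (C * ‖s‖) ^ 2 * η) * L + C * ‖s‖ * η := by
        refine add_le_add key (hlip.trans ?_)
        gcongr
    _ < min ε 1 := hbound
    _ ≤ ε := min_le_left _ _

/-! ## The Hebbian vector field of a continuous linear map -/

/-- This serves both components of the Hebbian field, with `b = a` and `b = a†`; the scalar `c = ⟪u,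
a v⟫` is common to them, which is why it enters only through its bounds. -/
theorem norm_clm_sub_smul_sub_le {X Y : Type*} [NormedAddCommGroup X] [NormedSpace ℝ X]
    [NormedAddCommGroup Y] [NormedSpace ℝ Y] (b : Y →L[ℝ] X) {x x' : X} {y y' : Y}
    {c c' K R δ : ℝ} (hK : ‖b‖ ≤ K) (hx' : ‖x'‖ ≤ R) (hx : ‖x - x'‖ ≤ δ) (hy : ‖y - y'‖ ≤ δ)
    (hc : |c| ≤ K * R ^ 2) (hd : |c - c'| ≤ K * (2 * R * δ)) :
    ‖(b y - c • x) - (b y' - c' • x')‖ ≤ (1 + 3 * R ^ 2) * K * δ := by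
  have hK0 : 0 ≤ K := (norm_nonneg _).trans hK
  have hR : 0 ≤ R := (norm_nonneg _).trans hx'
  have hδ : 0 ≤ δ := (norm_nonneg _).trans hx
  have e : (b y - c • x) - (b y' - c' • x') =
      b (y - y') - (c • (x - x') + (c - c') • x') := by
    rw [map_sub, smul_sub, sub_smul]; abel
  rw [e]
  calc _ ≤ _ := norm_sub_le _ _
    _ ≤ ‖b (y - y')‖ + (‖c • (x - x')‖ + ‖(c - c') • x'‖) := by
      gcongr; exact norm_add_le _ _
    _ ≤ K * δ + (K * R ^ 2 * δ + K * (2 * R * δ) * R) := by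
      rw [norm_smul, norm_smul, Real.norm_eq_abs, Real.norm_eq_abs]
      gcongr
      exact (b.le_opNorm _).trans (by gcongr)
    _ = _ := by ring

/-- The flow of a bounded linear vector field: global and nowhere vanishing. -/
theorem exists_linear_flow {E : Type*} [NormedAddCommGroup E] [NormedSpace ℝ E] [CompleteSpace E]
    (B : E →L[ℝ] E) (z₀ : E) (hz₀ : z₀ ≠ 0) :
    ∃ Z : ℝ → E, Z 0 = z₀ ∧ (∀ t, HasDerivAt Z (B (Z t)) t) ∧ ∀ t, Z t ≠ 0 := by
  refine ⟨fun t => NormedSpace.exp (t • B) z₀, by simp, fun t => ?_, fun t ht => hz₀ ?_⟩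
  · have := (hasDerivAt_exp_smul_const' (𝕂 := ℝ) B t).clm_apply (hasDerivAt_const t z₀)
    simpa using this
  · let : NormedAlgebra ℚ (E →L[ℝ] E) := NormedAlgebra.restrictScalars ℚ ℝ _
    have hinj : Function.Injective (NormedSpace.exp (t • B) : E →L[ℝ] E) :=
      ((ContinuousLinearMap.isUnit_iff_bijective).1 (NormedSpace.isUnit_exp (t • B))).1
    exact hinj (by rw [map_zero]; exact ht)

theorem abs_inner_clm_apply_le {G H : Type*} [NormedAddCommGroup G] [InnerProductSpace ℝ G]
    [NormedAddCommGroup H] [InnerProductSpace ℝ H] (a : G →L[ℝ] H) (u : H) (v : G) :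
    |inner ℝ u (a v)| ≤ ‖a‖ * (‖u‖ * ‖v‖) := by
  calc |inner ℝ u (a v)| ≤ ‖u‖ * ‖a v‖ := abs_real_inner_le_norm _ _
    _ ≤ ‖u‖ * (‖a‖ * ‖v‖) := by gcongr; exact a.le_opNorm v
    _ = _ := by ring

section HebbianField

variable {G H : Type*} [NormedAddCommGroup G] [InnerProductSpace ℝ G] [CompleteSpace G]
  [NormedAddCommGroup H] [InnerProductSpace ℝ H] [CompleteSpace H]

/-- The vector field `(u, v) ↦ (a v - ⟪u, a v⟫ u, a† u - ⟪u, a v⟫ v)`. -/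
noncomputable def hebbianField (a : G →L[ℝ] H) (w : H × G) : H × G :=
  (a w.2 - (inner ℝ w.1 (a w.2)) • w.1, a.adjoint w.1 - (inner ℝ w.1 (a w.2)) • w.2)

/-- The linear part contributes `1` and the cubic part `3 R ^ 2`. Averaging uses `R = 2`; uniqueness
needs arbitrary `R`, since a competing solution has no a priori bound. -/
theorem norm_hebbianField_sub_le (a : G →L[ℝ] H) {R : ℝ} {w w' : H × G}
    (hw : ‖w‖ ≤ R) (hw' : ‖w'‖ ≤ R) :
    ‖hebbianField a w - hebbianField a w'‖ ≤ (1 + 3 * R ^ 2) * ‖a‖ * ‖w - w'‖ := by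
  have hR : 0 ≤ R := (norm_nonneg _).trans hw
  have h1 := (norm_fst_le w).trans hw
  have h2 := (norm_snd_le w).trans hw
  have h1' := (norm_fst_le w').trans hw'
  have h2' := (norm_snd_le w').trans hw'
  have d1 : ‖w.1 - w'.1‖ ≤ ‖w - w'‖ := norm_fst_le (w - w')
  have d2 : ‖w.2 - w'.2‖ ≤ ‖w - w'‖ := norm_snd_le (w - w')
  have hc : |inner ℝ w.1 (a w.2)| ≤ ‖a‖ * R ^ 2 := by
    refine (abs_inner_clm_apply_le a _ _).trans ?_
    rw [pow_two]; gcongr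
  have hd : |inner ℝ w.1 (a w.2) - inner ℝ w'.1 (a w'.2)| ≤ ‖a‖ * (2 * R * ‖w - w'‖) := by
    have e : inner ℝ w.1 (a w.2) - inner ℝ w'.1 (a w'.2) =
        inner ℝ (w.1 - w'.1) (a w.2) + inner ℝ w'.1 (a (w.2 - w'.2)) := by
      rw [inner_sub_left, map_sub, inner_sub_right]; ring
    rw [e]
    calc _ ≤ _ := abs_add_le _ _
      _ ≤ ‖a‖ * (‖w - w'‖ * R) + ‖a‖ * (R * ‖w - w'‖) := by
        gcongr
        · exact (abs_inner_clm_apply_le a _ _).trans (by gcongr)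
        · exact (abs_inner_clm_apply_le a _ _).trans (by gcongr)
      _ = _ := by ring
  rw [hebbianField, hebbianField, Prod.mk_sub_mk, Prod.norm_mk]
  exact max_le (norm_clm_sub_smul_sub_le a le_rfl h1' d1 d2 hc hd)
    (norm_clm_sub_smul_sub_le a.adjoint (LinearIsometryEquiv.norm_map _ a).le h2' d2 d1 hc hd)

/-- At `R = 2` the Lipschitz factor is `13`; comparison with the zero at the origin gives the norm
bound `13 * 2 = 26`, which serves for both. -/
theorem isAdditiveField_hebbianField :
    IsAdditiveField (hebbianField : (G →L[ℝ] H) → H × G → H × G) 26 where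
  map_sub a b w := by
    simp only [hebbianField, map_sub, _root_.sub_apply, inner_sub_right, sub_smul,
      Prod.mk_sub_mk, Prod.mk.injEq]
    constructor <;> abel
  norm_le a w hw := by
    have h := norm_hebbianField_sub_le a hw (w' := 0) (by simp)
    have h0 : hebbianField a (0 : H × G) = 0 := by simp [hebbianField]
    rw [h0, sub_zero, sub_zero] at h
    calc _ ≤ _ := h
      _ ≤ (1 + 3 * 2 ^ 2) * ‖a‖ * 2 := by gcongr
      _ = _ := by ring
  norm_sub_le a w w' hw hw' := (norm_hebbianField_sub_le a hw hw').trans <| by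
    gcongr
    norm_num

/-- The linear field `(u, v) ↦ (a v, a† u)`, whose flow projects to the Hebbian flow. -/
noncomputable def offDiagonal (a : G →L[ℝ] H) : H × G →L[ℝ] H × G :=
  (a.comp (ContinuousLinearMap.snd ℝ H G)).prod
    (a.adjoint.comp (ContinuousLinearMap.fst ℝ H G))

/-- The Hebbian flow exists for all times and stays on the product of the unit spheres: it is the
normalized flow of the linear field `(u, v) ↦ (a v, a† u)`. -/
theorem exists_hebbian_flow (a : G →L[ℝ] H) (w₀ : H × G) (h1 : ‖w₀.1‖ = 1) (h2 : ‖w₀.2‖ = 1) :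
    ∃ W : ℝ → H × G, W 0 = w₀ ∧ (∀ t, HasDerivAt W (hebbianField a (W t)) t) ∧
      ∀ t, ‖W t‖ ≤ 1 := by
  obtain ⟨Z, hZ0, hZ, hne⟩ := exists_linear_flow (offDiagonal a) w₀ (by
    rintro rfl
    simp at h1)
  have hZ1 : ∀ t, HasDerivAt (fun t => (Z t).1) (a (Z t).2) t := fun t =>
    (ContinuousLinearMap.fst ℝ H G).hasFDerivAt.comp_hasDerivAt t (hZ t)
  have hZ2 : ∀ t, HasDerivAt (fun t => (Z t).2) (a.adjoint (Z t).1) t := fun t =>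
    (ContinuousLinearMap.snd ℝ H G).hasFDerivAt.comp_hasDerivAt t (hZ t)
  have hsq1 := fun t => (hZ1 t).norm_sq
  have hsq2 := fun t => (hZ2 t).norm_sq
  -- Both squared norms have derivative `2 ⟪Z₁, a Z₂⟫` and both start at `1`. Hence one scalar
  -- normalizes both components, and it cannot vanish because `Z` does not.
  have hsq : ∀ t, ‖(Z t).1‖ ^ 2 = ‖(Z t).2‖ ^ 2 := by
    have hd : ∀ t, HasDerivAt (fun t => ‖(Z t).1‖ ^ 2 - ‖(Z t).2‖ ^ 2) 0 t := fun t => by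
      refine ((hsq1 t).sub (hsq2 t)).congr_deriv ?_
      rw [ContinuousLinearMap.adjoint_inner_right, real_inner_comm, sub_self]
    intro t
    have := is_const_of_deriv_eq_zero (fun t => (hd t).differentiableAt)
      (fun t => (hd t).deriv) t 0
    simp only [hZ0, h1, h2] at this
    linarith
  have hpos : ∀ t, 0 < ‖(Z t).1‖ := by
    intro t
    refine norm_pos_iff.2 fun h => hne t (Prod.ext h ?_)
    have := hsq t
    rw [h, norm_zero] at this
    exact norm_eq_zero.1 (pow_eq_zero_iff two_ne_zero |>.1 (by linarith))
  have hnorm : ∀ t, ‖(Z t).1‖ = ‖(Z t).2‖ := fun t =>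
    (pow_left_inj₀ (norm_nonneg _) (norm_nonneg _) two_ne_zero).1 (hsq t)
  have hρ : ∀ t, HasDerivAt (fun t => ‖(Z t).1‖)
      (inner ℝ (Z t).1 (a (Z t).2) / ‖(Z t).1‖) t := fun t => by
    have h := (hsq1 t).sqrt (by have := hpos t; positivity)
    simp only [Real.sqrt_sq (norm_nonneg _)] at h
    refine h.congr_deriv ?_
    rw [mul_div_mul_left _ _ two_ne_zero]
  refine ⟨fun t => ‖(Z t).1‖⁻¹ • Z t, by simp [hZ0, h1], fun t => ?_, fun t => ?_⟩
  · have hp := (hpos t).ne'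
    refine (((hρ t).fun_inv hp).fun_smul (hZ t)).congr_deriv ?_
    have hc : inner ℝ (‖(Z t).1‖⁻¹ • (Z t).1) (a (‖(Z t).1‖⁻¹ • (Z t).2)) =
        inner ℝ (Z t).1 (a (Z t).2) / ‖(Z t).1‖ ^ 2 := by
      rw [map_smul, real_inner_smul_left, real_inner_smul_right]
      field_simp
    have hc' : -(inner ℝ (Z t).1 (a (Z t).2) / ‖(Z t).1‖) / ‖(Z t).1‖ ^ 2 =
        -(inner ℝ (Z t).1 (a (Z t).2) / ‖(Z t).1‖ ^ 2 * ‖(Z t).1‖⁻¹) := by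
      field_simp
    rw [hc']
    simp only [hebbianField, Prod.smul_fst, Prod.smul_snd, hc]
    ext1
    · simp [offDiagonal, smul_smul, sub_eq_add_neg]
    · simp [offDiagonal, smul_smul, sub_eq_add_neg]
  · rw [norm_smul, norm_inv, norm_norm, Prod.norm_def, ← hnorm t, max_self,
      inv_mul_cancel₀ (hpos t).ne']

/-- Two forward solutions of the Hebbian flow with the same initial value agree. -/
theorem hebbian_flow_unique (a : G →L[ℝ] H) {f g : ℝ → H × G}
    (hf : ∀ t, 0 ≤ t → HasDerivWithinAt f (hebbianField a (f t)) (Ici 0) t)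
    (hg : ∀ t, 0 ≤ t → HasDerivWithinAt g (hebbianField a (g t)) (Ici 0) t)
    (h0 : f 0 = g 0) {t : ℝ} (ht : 0 ≤ t) : f t = g t := by
  have hsub : Icc 0 t ⊆ Ici 0 := fun x hx => hx.1
  have hfc : ContinuousOn f (Icc 0 t) := fun x hx => ((hf x hx.1).continuousWithinAt).mono hsub
  have hgc : ContinuousOn g (Icc 0 t) := fun x hx => ((hg x hx.1).continuousWithinAt).mono hsub
  obtain ⟨Rf, hRf⟩ := isCompact_Icc.exists_bound_of_continuousOn hfc
  obtain ⟨Rg, hRg⟩ := isCompact_Icc.exists_bound_of_continuousOn hgc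
  -- By compactness of `[0,t]` both trajectories lie in one ball, on which the field is Lipschitz.
  set R := max Rf Rg
  have hlip : LipschitzOnWith (Real.toNNReal ((1 + 3 * R ^ 2) * ‖a‖)) (hebbianField a)
      {w | ‖w‖ ≤ R} := by
    refine LipschitzOnWith.of_dist_le_mul fun w hw w' hw' => ?_
    rw [Real.coe_toNNReal _ (by positivity), dist_eq_norm, dist_eq_norm]
    exact norm_hebbianField_sub_le a hw hw'
  exact ODE_solution_unique_of_mem_Icc_right (v := fun _ => hebbianField a)
    (s := fun _ => {w | ‖w‖ ≤ R}) (fun _ _ => hlip) hfc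
    (fun x hx => (hf x hx.1).mono (Ici_subset_Ici.2 hx.1))
    (fun x hx => (hRf x (Ico_subset_Icc_self hx)).trans (le_max_left _ _)) hgc
    (fun x hx => (hg x hx.1).mono (Ici_subset_Ici.2 hx.1))
    (fun x hx => (hRg x (Ico_subset_Icc_self hx)).trans (le_max_right _ _)) h0
    (right_mem_Icc.2 ht)

end HebbianField

/-! ## Step paths and convergence in distribution in the Skorokhod space -/

theorem mem_skorokhodNhd_of_dist_lt {E : Type*} [PseudoMetricSpace E] {x y : CadlagPath E}
    {T : ℝ≥0} {ε : ℝ} (hε : 0 < ε) (h : ∀ t ≤ T, dist (y t) (x t) < ε) :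
    y ∈ CadlagPath.skorokhodNhd x T ε :=
  ⟨OrderIso.refl _, fun t ht => ⟨by simpa using hε, h t ht⟩⟩

/-- The interpolation `t ↦ z ⌊t/η⌋` depends continuously on the sequence `z`. -/
theorem continuous_stepPath {E : Type*} [PseudoMetricSpace E] (η : ℝ) :
    Continuous (stepPath η : (ℕ → E) → CadlagPath E) := by
  refine continuous_def.2 fun O hO => isOpen_iff_mem_nhds.2 fun z hz => ?_
  obtain ⟨T, ε, hε, hsub⟩ := hO _ hz
  -- On `[0,T]` the path sees only the finitely many indices `k ≤ ⌊T/η⌋`, so closeness there is an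
  -- open condition in the product topology.
  have hev : ∀ᶠ z' in 𝓝 z, ∀ k ∈ Finset.range (⌊(T : ℝ) / η⌋₊ + 1), dist (z' k) (z k) < ε :=
    (Finset.eventually_all _).2 fun k _ =>
      (continuous_apply k).tendsto z |>.eventually (Metric.ball_mem_nhds (z k) hε)
  filter_upwards [hev] with z' hz'
  refine hsub (mem_skorokhodNhd_of_dist_lt hε fun t ht => hz' _ ?_)
  rw [Finset.mem_range, Nat.lt_succ_iff]
  have ht' : (t : ℝ) ≤ T := ht
  rcases le_or_gt η 0 with hη | hη
  · rw [Nat.floor_of_nonpos (div_nonpos_of_nonneg_of_nonpos t.coe_nonneg hη)]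
    exact Nat.zero_le _
  · exact Nat.floor_mono (by gcongr)

/-- Local uniform convergence implies convergence in the Skorokhod topology. -/
theorem tendsto_skorokhod_of_locally_uniform {ι E : Type*} [PseudoMetricSpace E] {l : Filter ι}
    {y : ι → CadlagPath E} {x : CadlagPath E}
    (h : ∀ (T : ℝ≥0) (ε : ℝ), 0 < ε → ∀ᶠ i in l, ∀ t ≤ T, dist (y i t) (x t) < ε) :
    Tendsto y l (𝓝 x) := by
  refine tendsto_nhds.2 fun O hO hx => ?_
  obtain ⟨T, ε, hε, hsub⟩ := hO x hx
  filter_upwards [h T ε hε] with i hi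
  exact hsub (mem_skorokhodNhd_of_dist_lt hε hi)

/-- Almost sure convergence to a constant implies convergence in distribution, in any topological
space with its Borel σ-algebra. -/
theorem tendstoInDistribution_const_of_ae_tendsto {Ω ι S : Type*} [MeasurableSpace Ω]
    {P : Measure Ω} [IsProbabilityMeasure P] [TopologicalSpace S] [MeasurableSpace S]
    [OpensMeasurableSpace S] {l : Filter ι} [l.IsCountablyGenerated] {Z : ι → Ω → S} {c : S}
    (hZ : ∀ i, AEMeasurable (Z i) P) (h : ∀ᵐ ω ∂P, Tendsto (fun i => Z i ω) l (𝓝 c)) :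
    TendstoInDistribution Z l (fun _ => c) (fun _ => P) P where
  forall_aemeasurable := hZ
  aemeasurable_limit := aemeasurable_const
  tendsto := by
    refine ProbabilityMeasure.tendsto_iff_forall_integral_tendsto.2 fun f => ?_
    have hf : Measurable f := f.continuous.measurable
    simp only [ProbabilityMeasure.coe_mk]
    rw [integral_map aemeasurable_const hf.aestronglyMeasurable]
    simp only [fun i => integral_map (hZ i) hf.aestronglyMeasurable]
    refine tendsto_integral_filter_of_dominated_convergence (fun _ => ‖f‖)
      (Eventually.of_forall fun i => (hf.comp_aemeasurable (hZ i)).aestronglyMeasurable)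
      (Eventually.of_forall fun i => Eventually.of_forall fun ω => f.norm_coe_le_norm _)
      (integrable_const _) ?_
    filter_upwards [h] with ω hω
    exact (f.continuous.tendsto c).comp hω

/-- A continuous path, as a càdlàg path. -/
def CadlagPath.ofContinuous {E : Type*} [TopologicalSpace E] (f : ℝ≥0 → E) (hf : Continuous f) :
    CadlagPath E where
  toFun := f
  right_cont' _ := hf.continuousWithinAt
  left_lim' t := ⟨f t, hf.continuousWithinAt⟩

/-! ## The generalized Hebbian algorithm -/

section GHA

variable {m d : ℕ}

/-- A matrix as a continuous linear map between Euclidean spaces. -/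
noncomputable def matrixCLM (M : Matrix (Fin m) (Fin d) ℝ) :
    EuclideanSpace ℝ (Fin d) →L[ℝ] EuclideanSpace ℝ (Fin m) :=
  LinearMap.toContinuousLinearMap M.toEuclideanLin

theorem ghaField_eq_hebbianField (M : Matrix (Fin m) (Fin d) ℝ) (w : VecPair m d) :
    ghaField M w = hebbianField (matrixCLM M) w := by
  have h : Mᵀ.toEuclideanLin = M.toEuclideanLin.adjoint := by
    rw [← Matrix.conjTranspose_eq_transpose_of_trivial,
      Matrix.toEuclideanLin_conjTranspose_eq_adjoint]
  rw [ghaField, hebbianField, h, LinearMap.adjoint_eq_toCLM_adjoint]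
  rfl

/-- The outer product `x yᵀ` is the rank-one map `v ↦ ⟪y, v⟫ x`. -/
theorem matrixCLM_vecMulVec (x : EuclideanSpace ℝ (Fin m)) (y : EuclideanSpace ℝ (Fin d)) :
    matrixCLM (Matrix.vecMulVec x y) = InnerProductSpace.rankOne ℝ x y := by
  ext v i
  simp [matrixCLM, Matrix.vecMulVec_mulVec, InnerProductSpace.rankOne_apply,
    EuclideanSpace.inner_eq_star_dotProduct, dotProduct_comm, mul_comm]

theorem integrable_norm_mul_norm {𝓓 : Measure (VecPair m d)} [IsFiniteMeasure 𝓓] {p : ℝ≥0∞}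
    (hp : 2 ≤ p) (hX : MemLp (fun p : VecPair m d => p.1) p 𝓓)
    (hY : MemLp (fun p : VecPair m d => p.2) p 𝓓) :
    Integrable (fun p : VecPair m d => ‖p.1‖ * ‖p.2‖) 𝓓 :=
  (hX.mono_exponent hp).norm.integrable_mul (hY.mono_exponent hp).norm

theorem continuous_rankOne : Continuous fun p : VecPair m d =>
    (InnerProductSpace.rankOne ℝ p.1 p.2 :
      EuclideanSpace ℝ (Fin d) →L[ℝ] EuclideanSpace ℝ (Fin m)) := by
  have h : Continuous fun p : VecPair m d =>
      (ContinuousLinearMap.smulRightL ℝ _ (EuclideanSpace ℝ (Fin m)) (innerSL ℝ p.2)) p.1 :=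
    ((ContinuousLinearMap.smulRightL ℝ _ (EuclideanSpace ℝ (Fin m))).continuous.comp
      ((innerSL ℝ).continuous.comp continuous_snd)).clm_apply continuous_fst
  refine h.congr fun p => ?_
  ext v
  simp [InnerProductSpace.rankOne_apply]

theorem integrable_rankOne {𝓓 : Measure (VecPair m d)}
    (h : Integrable (fun p : VecPair m d => ‖p.1‖ * ‖p.2‖) 𝓓) :
    Integrable (fun p : VecPair m d => (InnerProductSpace.rankOne ℝ p.1 p.2 :
      EuclideanSpace ℝ (Fin d) →L[ℝ] EuclideanSpace ℝ (Fin m))) 𝓓 :=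
  h.mono' continuous_rankOne.aestronglyMeasurable <| Eventually.of_forall fun p => by
    rw [InnerProductSpace.norm_rankOne]

/-- Each matrix entry is a continuous linear functional `L`, hence commutes with the Bochner
integral. This identifies the limit in the operator-valued strong law. -/
theorem integral_rankOne {𝓓 : Measure (VecPair m d)}
    (h : Integrable (fun p : VecPair m d => ‖p.1‖ * ‖p.2‖) 𝓓) :
    ∫ p, (InnerProductSpace.rankOne ℝ p.1 p.2 :
      EuclideanSpace ℝ (Fin d) →L[ℝ] EuclideanSpace ℝ (Fin m)) ∂𝓓 =
      matrixCLM (crossMoment 𝓓) := by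
  have hR := integrable_rankOne h
  refine ContinuousLinearMap.coe_injective
    ((EuclideanSpace.basisFun (Fin d) ℝ).toBasis.ext fun j => ?_)
  ext i
  let L : (EuclideanSpace ℝ (Fin d) →L[ℝ] EuclideanSpace ℝ (Fin m)) →L[ℝ] ℝ :=
    (EuclideanSpace.proj i).comp
      (ContinuousLinearMap.apply ℝ (EuclideanSpace ℝ (Fin m)) (EuclideanSpace.single j 1))
  have key := L.integral_comp_comm hR
  simp only [L, ContinuousLinearMap.comp_apply, ContinuousLinearMap.apply_apply,
    InnerProductSpace.rankOne_apply] at key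
  simp only [OrthonormalBasis.coe_toBasis, EuclideanSpace.basisFun_apply,
    ContinuousLinearMap.coe_coe]
  refine key.symm.trans ?_
  simp [matrixCLM, crossMoment, EuclideanSpace.inner_single_right, mul_comm]

/-- Each iterate is a polynomial in the samples. Together with `continuous_stepPath` this makes the
interpolated process measurable for the Skorokhod Borel σ-algebra. -/
theorem continuous_ghaIter (η : ℝ) (w₀ : VecPair m d) (k : ℕ) :
    Continuous fun z : ℕ → VecPair m d => ghaIter η w₀ (fun k => (z k).1) (fun k => (z k).2) k := by
  induction k with
  | zero => exact continuous_const
  | succ k ih =>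
    simp only [ghaIter, ghaField_eq_hebbianField, matrixCLM_vecMulVec, hebbianField,
      InnerProductSpace.adjoint_rankOne, InnerProductSpace.rankOne_apply]
    fun_prop

end GHA

theorem mainTheorem2 {Ω : Type*} [MeasurableSpace Ω] (P : Measure Ω) [IsProbabilityMeasure P]
    (m d : ℕ) (𝓓 : Measure (VecPair m d))
    (X : ℕ → Ω → EuclideanSpace ℝ (Fin m)) (Y : ℕ → Ω → EuclideanSpace ℝ (Fin d))
    (hlaw : ∀ k, HasLaw (fun ω => (X k ω, Y k ω)) 𝓓 P)
    (hindep : iIndepFun (fun k ω => (X k ω, Y k ω)) P)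
    (Δ : ℝ) (hΔ : 0 < Δ)
    (hX : MemLp (fun p : VecPair m d => p.1) (ENNReal.ofReal (4 + Δ)) 𝓓)
    (hY : MemLp (fun p : VecPair m d => p.2) (ENNReal.ofReal (4 + Δ)) 𝓓)
    (u₀ : EuclideanSpace ℝ (Fin m)) (v₀ : EuclideanSpace ℝ (Fin d))
    (hu₀ : ‖u₀‖ = 1) (hv₀ : ‖v₀‖ = 1) :
    ∃ W : CadlagPath (VecPair m d),
      IsGhaSolution (crossMoment 𝓓) (u₀, v₀) W ∧
      (∀ W' : ℝ≥0 → VecPair m d, IsGhaSolution (crossMoment 𝓓) (u₀, v₀) W' → W' = W) ∧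
      TendstoInDistribution
        (fun (η : ℝ) ω =>
          stepPath η (ghaIter η (u₀, v₀) (fun k => X k ω) (fun k => Y k ω)))
        (𝓝[>] 0) (fun _ => W) (fun _ => P) P := by
  have : IsProbabilityMeasure 𝓓 := ((hlaw 0).isProbabilityMeasure_iff).1 inferInstance
  obtain ⟨Wr, hW0, hWd, hWb⟩ :=
    exists_hebbian_flow (matrixCLM (crossMoment 𝓓)) (u₀, v₀) hu₀ hv₀
  have hWc : Continuous fun t : ℝ≥0 => Wr t :=
    (continuous_iff_continuousAt.2 fun t => (hWd t).continuousAt).comp NNReal.continuous_coe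
  refine ⟨CadlagPath.ofContinuous _ hWc, ⟨?_, fun t => ?_⟩, fun W' hW' => funext fun t => ?_,
    tendstoInDistribution_const_of_ae_tendsto (fun η => ?_) ?_⟩
  · exact hW0
  · rw [ghaField_eq_hebbianField]
    refine (hWd t).hasDerivWithinAt.congr_of_mem (fun s hs => ?_) t.coe_nonneg
    exact congrArg Wr (Real.coe_toNNReal s hs)
  · have h := hebbian_flow_unique (matrixCLM (crossMoment 𝓓)) (f := fun s => W' s.toNNReal)
      (g := Wr) (fun s hs => by
        have := hW'.2 s.toNNReal
        rwa [ghaField_eq_hebbianField, Real.coe_toNNReal s hs] at this)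
      (fun s _ => (hWd s).hasDerivWithinAt) (by simp [hW0, hW'.1]) t.coe_nonneg
    rw [Real.toNNReal_coe] at h
    exact h
  · refine (continuous_stepPath η).measurable.comp_aemeasurable
      (aemeasurable_pi_iff.2 fun k => ?_)
    exact (continuous_ghaIter η (u₀, v₀) k).measurable.comp_aemeasurable
      (aemeasurable_pi_iff.2 fun j => (hlaw j).aemeasurable)
  have hint : Integrable (fun p : VecPair m d => ‖p.1‖ * ‖p.2‖) 𝓓 :=
    integrable_norm_mul_norm
      (by
        rw [← ENNReal.ofReal_ofNat 2]
        exact ENNReal.ofReal_le_ofReal (by linarith)) hX hY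
  let R : VecPair m d → EuclideanSpace ℝ (Fin d) →L[ℝ] EuclideanSpace ℝ (Fin m) :=
    fun p => InnerProductSpace.rankOne ℝ p.1 p.2
  have hR : Measurable R := continuous_rankOne.measurable
  have hRint : Integrable R 𝓓 := integrable_rankOne hint
  let A : ℕ → Ω → EuclideanSpace ℝ (Fin d) →L[ℝ] EuclideanSpace ℝ (Fin m) :=
    fun k ω => R (X k ω, Y k ω)
  have hid : ∀ k, IdentDistrib (A k) (A 0) P P := fun k => ((hlaw k).identDistrib (hlaw 0)).comp hR
  have hA0 : Integrable (A 0) P := by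
    have h := hRint
    rw [← (hlaw 0).map_eq] at h
    exact h.comp_aemeasurable (hlaw 0).aemeasurable
  have hAmean : ∫ ω, A 0 ω ∂P = matrixCLM (crossMoment 𝓓) := by
    rw [← integral_rankOne hint]
    exact (hlaw 0).integral_comp hRint.aestronglyMeasurable
  have hind : iIndepFun A P := hindep.comp (fun _ => R) fun _ => hR
  -- The first law controls the centred sums, the second, for the norms, the variation of the
  -- iterates.
  have hslln := strong_law_ae A hA0 (fun i j hij => hind.indepFun hij) hid
  have hslln' := strong_law_ae (fun k ω => ‖A k ω‖) hA0.norm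
    (fun i j hij => (hind.indepFun hij).comp measurable_norm measurable_norm)
    fun k => (hid k).comp measurable_norm
  -- The exceptional null set is chosen before `η`, so the limit may be taken along all real `η →
  -- 0⁺`.
  filter_upwards [hslln, hslln'] with ω h1 h2
  rw [hAmean] at h1
  refine tendsto_skorokhod_of_locally_uniform fun T ε hε => ?_
  have key := isAdditiveField_hebbianField.eventually_dist_iter_lt (by norm_num)
    (fun t _ => (hWd t).hasDerivWithinAt) (fun t _ => hWb t) (A := fun k => A k ω)
    (w := fun η => ghaIter η (u₀, v₀) (fun k => X k ω) (fun k => Y k ω))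
    (fun η => by rw [hW0]; rfl)
    (fun η k => by
      simp only [ghaIter, ghaField_eq_hebbianField, matrixCLM_vecMulVec, A, R])
    h1 h2 T.coe_nonneg hε
  filter_upwards [key] with η hη t ht
  exact hη t t.coe_nonneg (by exact_mod_cast ht)
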